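/- Let $n\ge 0$ and let $\mathcal C=\{a_1<\cdots<a_n\}$ be an ordered set of primary colors, with secondary colors $a_ia_j$ ($1\le i<j\le n$). Order all the colors by $$a_1a_2<\cdots<a_1a_n<a_1<a_2a_3<\cdots<a_2a_n<a_2<\cdots<a_{n-1}a_n<a_{n-1}<a_n .$$ For colored integers write $k_p\succ l_q$ iff $k-l\ge\chi(p\le q)$ (where $\chi$ of a statement is $1$ if it is true and $0$ otherwise), write $\succeq$ for "$\succ$ or equal", and put $k_p+t=(k+t)_p$. Let $\mathcal P$ be the set of parts of primary color and size $\ge1$, and $\mathcal S$ the set of parts of secondary color and size $\ge 2$. A pair of secondary colors $(a_ka_l,a_ia_j)$ (with $k<l$ and $i<j$) is special if $i<j<k<l$ or $k<i<j<l$. On $\mathcal P\sqcup\mathcal S$ define two relations: * $k_p\triangleright l_q$ iff $k_p\succeq (l+1)_q$ if $p$ or $q$ is primary, and iff $k_p\succ(l+1)_q$ if both are secondary; * $k_p\gg l_q$ iff $k_p\succeq (l+1)_q$ if $p$ or $q$ is primary, iff $k_p\succ(l+1)_q$ if both are secondary and $(p,q)$ is not special, and iff $k_p\succ l_q$ if $(p,q)$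 is special. Let $\mathcal O$ be the set of finite sequences $\lambda_1\succ\cdots\succ\lambda_t$ of parts in $\mathcal P$ (that is, partitions into distinct primary-colored parts), and $\mathcal E$ the set of finite sequences $\nu_1\gg\cdots\gg\nu_s$ of parts in $\mathcal P\sqcup\mathcal S$ (both sets include the empty sequence). The size $|\nu|$ is the sum of the part sizes, and the color product $C(\nu)$ is the product of the colors of the parts, seen as a commutative monomial in $a_1,\dots,a_n$. The upper and lower halves of a part in $\mathcal S$ are given by $\alpha((2k)_{a_ia_j})=k_{a_j}$, $\beta((2k)_{a_ia_j})=k_{a_i}$, $\alpha((2k+1)_{a_ia_j})=(k+1)_{a_i}$, $\beta((2k+1)_{a_ia_j})=k_{a_j}$. For $x\in\mathcal P$ put $\alpha(x)=x$. Let $\nu=(\nu_1,\dots,\nu_s)\in\mathcal E$ and let $\nu_i$ be a secondary part. Let $j$ be the least index $>i$ with $\nu_j$ primary, or $j=s+1$ if there is none. For $i<u\le s$ say that $u$ is admissible for $i$ if $$\beta(\nu_{i'})\not\succ\alpha(\nu_u)+(u-i')-1\qquad\text{for all } i\le i'<u .$$ Let $b(i)=j$ if $j\le s$ and $j$ is admissible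 for $i$; otherwise let $b(i)$ be the largest $u$ with $i<u<j$ that is admissible for $i$, if there is one, and $b(i)=i$ if there is none. The bridge of $\nu_i$ is the primary-colored part $\alpha(\nu_{b(i)})$, placed at position $b(i)$; and $\nu_i$ is $1$-different-distant from its bridge if $\nu_i\succeq\alpha(\nu_{b(i)})+(b(i)-i)$. Let $\mathcal E_1$ be the set of $\nu=(\nu_1,\dots,\nu_s)\in\mathcal E$ such that, for all $1\le i\le s-1$ with $\nu_{i-1}\triangleright\nu_i\not\triangleright\nu_{i+1}$ (where for $i=1$ the condition $\nu_{0}\triangleright\nu_1$ is regarded as satisfied), the part $\nu_i$, which is then secondary, is $1$-different-distant from its bridge. **Theorem.** For every commutative product $C$ of primary colors and every integer $m\ge0$, let $U(C,m)$ be the number of $\lambda\in\mathcal O$ with $(C(\lambda),|\lambda|)=(C,m)$ and $W(C,m)$ the number of $\nu\in\mathcal E_1$ with $(C(\nu),|\nu|)=(C,m)$. Both numbers are finite and $U(C,m)=W(C,m)$. Moreover, as formal power series in $a_1,\dots,a_n,q$ over $\mathbb Z$, $$\sum_{m,u_1,\dots,u_n\ge0}W\Big(\prod_{i=1}^n a_i^{u_i},m\Big)\prod_{i=1}^na_i^{u_i}\,q^m=\sum_{m,u_1,\dots,u_n\ge0}U\Big(\prod_{i=1}^n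 a_i^{u_i},m\Big)\prod_{i=1}^na_i^{u_i}\,q^m=\prod_{i=1}^n(-a_iq;q)_\infty ,$$ where $(x;q)_\infty=\prod_{k\ge0}(1-xq^k)$, and the infinite products converge in the topology of coefficientwise convergence. -/

import Mathlib

open scoped MvPowerSeries.WithPiTopology

namespace Goellnitz

/-- Primary colors `a_i` and secondary colors `a_i a_j` with `i < j`. -/
inductive Color (n : ℕ) : Type where
  | primary (i : Fin n) : Color n
  | secondary (i j : Fin n) (h : i < j) : Color n

namespace Color

variable {n : ℕ}

def IsPrimary : Color n → Prop
  | primary _ => True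
  | secondary _ _ _ => False

/-- Lexicographic key of the order
`a_1a_2 < ⋯ < a_1a_n < a_1 < a_2a_3 < ⋯ < a_2a_n < a_2 < ⋯ < a_{n-1}a_n < a_{n-1} < a_n`. -/
def key : Color n → ℕ ×ₗ ℕ
  | primary i => toLex ((i : ℕ), n)
  | secondary i j _ => toLex ((i : ℕ), (j : ℕ))

instance : LE (Color n) := ⟨fun p q => p.key ≤ q.key⟩

instance : DecidableLE (Color n) := fun p q => inferInstanceAs (Decidable (p.key ≤ q.key))

/-- The special pairs `(a_k a_l, a_i a_j)` with `i < j < k < l` or `k < i < j < l`. -/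
def IsSpecialPair : Color n → Color n → Prop
  | secondary k l _, secondary i j _ => (i < j ∧ j < k ∧ k < l) ∨ (k < i ∧ i < j ∧ j < l)
  | _, _ => False

/-- A color as a commutative product of primary colors, given by its exponent vector. -/
noncomputable def product : Color n → (Fin n →₀ ℕ)
  | primary i => Finsupp.single i 1
  | secondary i j _ => Finsupp.single i 1 + Finsupp.single j 1

end Color

/-- A colored number `k_p`: an integer `k` with a color `p`. -/
structure ColoredNumber (n : ℕ) : Type where
  size : ℤ
  color : Color n

namespace ColoredNumber

variable {n : ℕ}

/-- `k_p + t = (k + t)_p`. -/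
def shift (x : ColoredNumber n) (t : ℤ) : ColoredNumber n := ⟨x.size + t, x.color⟩

/-- `k_p ≻ l_q` if and only if `k - l ≥ χ(p ≤ q)`. -/
def Succ (x y : ColoredNumber n) : Prop :=
  x.size - y.size ≥ if x.color ≤ y.color then 1 else 0

/-- `k_p ⪰ l_q`. -/
def SuccEq (x y : ColoredNumber n) : Prop := x.Succ y ∨ x = y

/-- Membership in `𝒫`: a primary color and a positive size. -/
def IsPrimaryPart (x : ColoredNumber n) : Prop := x.color.IsPrimary ∧ 1 ≤ x.size

/-- Membership in `𝒮`: a secondary color and a size greater than one. -/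
def IsSecondaryPart (x : ColoredNumber n) : Prop := ¬ x.color.IsPrimary ∧ 1 < x.size

/-- The relation `▷`. -/
def Tri (x y : ColoredNumber n) : Prop :=
  (x.color.IsPrimary ∨ y.color.IsPrimary → x.SuccEq (y.shift 1)) ∧
  (¬ x.color.IsPrimary ∧ ¬ y.color.IsPrimary → x.Succ (y.shift 1))

/-- The relation `≫`. -/
def Gg (x y : ColoredNumber n) : Prop :=
  (x.color.IsPrimary ∨ y.color.IsPrimary → x.SuccEq (y.shift 1)) ∧
  (¬ x.color.IsPrimary ∧ ¬ y.color.IsPrimary ∧ ¬ Color.IsSpecialPair x.color y.color →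
    x.Succ (y.shift 1)) ∧
  (Color.IsSpecialPair x.color y.color → x.Succ y)

/-- The upper half `α`: `(2k)_{a_i a_j} ↦ k_{a_j}` and `(2k+1)_{a_i a_j} ↦ (k+1)_{a_i}`.
By convention a number of primary color is left unchanged. -/
def upperHalf : ColoredNumber n → ColoredNumber n
  | ⟨k, .primary i⟩ => ⟨k, .primary i⟩
  | ⟨k, .secondary i j _⟩ =>
      if k % 2 = 0 then ⟨k / 2, .primary j⟩ else ⟨k / 2 + 1, .primary i⟩

/-- The lower half `β`: `(2k)_{a_i a_j} ↦ k_{a_i}` and `(2k+1)_{a_i a_j} ↦ k_{a_j}`.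
By convention a number of primary color is left unchanged. -/
def lowerHalf : ColoredNumber n → ColoredNumber n
  | ⟨k, .primary i⟩ => ⟨k, .primary i⟩
  | ⟨k, .secondary i j _⟩ =>
      if k % 2 = 0 then ⟨k / 2, .primary i⟩ else ⟨k / 2, .primary j⟩

/-- `x`, at position `i` of a sequence, is `d`-different-distant from `y`, at position `j`:
`x ⪰ y + d (j - i)`. -/
def DifferentDistant (d : ℤ) (i j : ℕ) (x y : ColoredNumber n) : Prop :=
  x.SuccEq (y.shift (d * ((j : ℤ) - (i : ℤ))))

end ColoredNumber

section Partitions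

variable {n : ℕ}

/-- The set `𝒪` of sequences `λ_1 ≻ ⋯ ≻ λ_t` of parts in `𝒫`. -/
def setO (n : ℕ) : Set (List (ColoredNumber n)) :=
  {l | l.IsChain ColoredNumber.Succ ∧ ∀ x ∈ l, x.IsPrimaryPart}

/-- The set `ℰ` of sequences `ν_1 ≫ ⋯ ≫ ν_t` of parts in `𝒫 ⊔ 𝒮`. -/
def setE (n : ℕ) : Set (List (ColoredNumber n)) :=
  {l | l.IsChain ColoredNumber.Gg ∧ ∀ x ∈ l, x.IsPrimaryPart ∨ x.IsSecondaryPart}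

/-- The size of a partition: the sum of its part sizes. -/
def size (l : List (ColoredNumber n)) : ℤ := (l.map ColoredNumber.size).sum

/-- The color product of a partition, as a commutative product of primary colors. -/
noncomputable def colorProduct (l : List (ColoredNumber n)) : Fin n →₀ ℕ :=
  (l.map fun x => x.color.product).sum

/-- The position of the first primary part of `ν` after position `i`,
or the position just after the end of `ν` if there is none. Positions start from `0`. -/
noncomputable def nextPrimary (ν : List (ColoredNumber n)) (i : ℕ) : ℕ :=
  sInf {j | i < j ∧ (j = ν.length ∨ ∃ h : j < ν.length, ν[j].color.IsPrimary)}

/-- `u` is a position of `ν` and, for every position `i'` with `i ≤ i' < u`, the lower half of the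
part at `i'` is not `≻ x + (u - i') - 1`, where `x` is the part at `u` if that part is primary, and
its upper half if it is secondary. -/
def Reaches (ν : List (ColoredNumber n)) (i u : ℕ) : Prop :=
  ∃ hu : u < ν.length, ∀ (i' : ℕ) (_ : i ≤ i') (h : i' < u),
    ¬ (ν[i']'(h.trans hu)).lowerHalf.Succ
        (ν[u].upperHalf.shift ((u : ℤ) - (i' : ℤ) - 1))

open Classical in
/-- The position of the bridge of the part at position `i`, for a secondary part at `i`. -/
noncomputable def bridgeIndex (ν : List (ColoredNumber n)) (i : ℕ) : ℕ :=
  if Reaches ν i (nextPrimary ν i) then nextPrimary ν i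
  else if {u | i < u ∧ u < nextPrimary ν i ∧ Reaches ν i u}.Nonempty then
    sSup {u | i < u ∧ u < nextPrimary ν i ∧ Reaches ν i u}
  else i

theorem bridgeIndex_lt (ν : List (ColoredNumber n)) (i : ℕ) (hi : i < ν.length) :
    bridgeIndex ν i < ν.length := by
  unfold bridgeIndex
  split_ifs with h1 h2
  · exact h1.1
  · exact (Nat.sSup_mem h2 ⟨nextPrimary ν i, fun u hu => hu.2.1.le⟩).2.2.1
  · exact hi

/-- The bridge of the secondary part at position `i`: the part at the bridge position if that part
is primary, and its upper half otherwise. -/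
noncomputable def bridge (ν : List (ColoredNumber n)) (i : ℕ) (hi : i < ν.length) :
    ColoredNumber n :=
  (ν[bridgeIndex ν i]'(bridgeIndex_lt ν i hi)).upperHalf

/-- The set `ℰ₁`: the partitions in `ℰ` in which each part `ν_i` with `ν_{i-1} ▷ ν_i ⋫ ν_{i+1}`
is 1-different-distant from its bridge. For the first part of the partition there is no `ν_{i-1}`
and the condition `ν_{i-1} ▷ ν_i` is void. -/
def setE1 (n : ℕ) : Set (List (ColoredNumber n)) :=
  {ν | ν ∈ setE n ∧ ∀ (i : ℕ) (hi : i + 1 < ν.length),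
    (∀ _ : 0 < i, (ν[i - 1]).Tri ν[i]) → ¬ (ν[i]).Tri ν[i + 1] →
      (ν[i]).DifferentDistant 1 i (bridgeIndex ν i) (bridge ν i (by omega))}

/-- The partitions in `X` with color product `C` and size `m`. -/
def withColorSize (X : Set (List (ColoredNumber n))) (C : Fin n →₀ ℕ) (m : ℕ) :
    Set (List (ColoredNumber n)) :=
  {l | l ∈ X ∧ colorProduct l = C ∧ size l = (m : ℤ)}

/-- `U(C, m)`. -/
noncomputable def countU (C : Fin n →₀ ℕ) (m : ℕ) : ℕ := (withColorSize (setO n) C m).ncard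

/-- `W(C, m)`. -/
noncomputable def countW (C : Fin n →₀ ℕ) (m : ℕ) : ℕ := (withColorSize (setE1 n) C m).ncard

end Partitions

section Series

/-- Formal power series in `q, a_1, …, a_n` over `ℤ`; the variable `none` is `q`
and the variable `some i` is `a_i`. They carry the topology of coefficientwise convergence. -/
abbrev Series (n : ℕ) : Type := MvPowerSeries (Option (Fin n)) ℤ

noncomputable def varQ (n : ℕ) : Series n := MvPowerSeries.X none

noncomputable def varA {n : ℕ} (i : Fin n) : Series n := MvPowerSeries.X (some i)

/-- The term `c a_1^{u_1} ⋯ a_n^{u_n} q^m`. -/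
noncomputable def term {n : ℕ} (c : ℕ) (u : Fin n →₀ ℕ) (m : ℕ) : Series n :=
  (c : Series n) * (∏ i, varA i ^ u i) * varQ n ^ m

/-- `(x; q)_∞ = ∏_{k ≥ 0} (1 - x q^k)`. -/
noncomputable def qPochhammerInf {n : ℕ} (x : Series n) : Series n :=
  ∏' k : ℕ, (1 - x * varQ n ^ k)

end Series

end Goellnitz

set_option linter.unusedSimpArgs false

namespace Goellnitz

/-! A secondary part is a glued pair of primary parts: its halves `a`, `b` satisfy `a ≻ b` but `a ⋫
b`, and subtracting 1 from it turns the halves into `b`, `a - 1`. A sequence of parts becomes an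
element of `𝒪` by inserting its parts from the right. A primary part goes in front. A secondary part
crosses an entry `l` as long as its lower half is not `≻ l`; each crossing moves one unit of size
from it to `l`, and then it splits into its halves (`insertTwo`, `build`). Conversely, `extract`
recovers the part inserted last.

The two operations are inverse for a part `p` and a list `L` with `Valid p L`: `p ≫` the part
extracted from `L`, and `p ▷` the first entry of `L` (`extract_spec`, `extract_insertPiece`). The
crux is `Valid.two_lower`: validity survives a crossing. So `build` is a bijection from `Good`
sequences onto `𝒪`, and it preserves size and color product.

It remains to identify `Good` with `ℰ₁`. The first entry of the image of a tail is the upper half of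
the first part that does not move, raised once for each part crossing it (`exists_stopsAt`). For a
secondary part that moves, that upper half is its bridge; for one that does not, the conditions to
be compared both hold. So being `1`-different-distant means being `▷` the first entry of the image
of the tail (`differentDistant_iff`). `ℰ₁` demands this only where a run of `⋫` begins, but it
propagates to all positions (`tri_head_of_not_tri`, `tri_head_of_tri`).

For the product formula, elements of `𝒪` are finite sets of pairs of a color and a size, which index
the terms of the expanded product. -/

variable {n : ℕ}

/-! ### Primary numbers, halves and pieces -/

/-- `a ≻ b` for primary colored numbers, given as pairs of a size and a color index. -/
def Above (a b : ℤ × Fin n) : Prop :=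
  b.1 < a.1 ∨ (b.1 = a.1 ∧ (b.2 : ℕ) < a.2)

instance (a b : ℤ × Fin n) : Decidable (Above a b) := by unfold Above; infer_instance

def raise (a : ℤ × Fin n) : ℤ × Fin n := (a.1 + 1, a.2)

def lower (a : ℤ × Fin n) : ℤ × Fin n := (a.1 - 1, a.2)

/-- `a ≻ b` but `a ⋫ b`: the two primary parts can be merged into a secondary part. -/
def Linked (a b : ℤ × Fin n) : Prop := Above a b ∧ Above (raise b) a

instance (a b : ℤ × Fin n) : Decidable (Linked a b) := by unfold Linked; infer_instance

@[simp] theorem raise_lower (a : ℤ × Fin n) : raise (lower a) = a := by simp [raise, lower]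

@[simp] theorem lower_raise (a : ℤ × Fin n) : lower (raise a) = a := by simp [raise, lower]

@[simp] theorem raise_fst (a : ℤ × Fin n) : (raise a).1 = a.1 + 1 := rfl

@[simp] theorem raise_snd (a : ℤ × Fin n) : (raise a).2 = a.2 := rfl

@[simp] theorem lower_fst (a : ℤ × Fin n) : (lower a).1 = a.1 - 1 := rfl

@[simp] theorem lower_snd (a : ℤ × Fin n) : (lower a).2 = a.2 := rfl

/-- A primary part, or a secondary part given by its upper and lower halves. -/
inductive Piece (n : ℕ) : Type where
  | one (a : ℤ × Fin n) : Piece n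
  | two (a b : ℤ × Fin n) : Piece n

namespace Piece

/-- Adding 1 exchanges the roles of the halves: the old lower half, plus 1, becomes the upper one.
-/
def raise : Piece n → Piece n
  | one a => one (Goellnitz.raise a)
  | two a b => two (Goellnitz.raise b) a

/-- The relation `▷` in terms of halves. -/
def Tri : Piece n → Piece n → Prop
  | one a, one b => b.1 + 1 < a.1 ∨ (b.1 + 1 = a.1 ∧ (b.2 : ℕ) ≤ a.2)
  | one a, two c d =>
      c.1 + d.1 + 1 < a.1 ∨ (c.1 + d.1 + 1 = a.1 ∧ min (c.2 : ℕ) d.2 ≤ a.2)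
  | two a b, one c => c.1 + 1 < a.1 + b.1 ∨ (c.1 + 1 = a.1 + b.1 ∧ (c.2 : ℕ) < min (a.2 : ℕ) b.2)
  | two a b, two c d => c.1 + d.1 + 1 < a.1 + b.1 ∨ (c.1 + d.1 + 1 = a.1 + b.1 ∧
      (min (c.2 : ℕ) d.2 < min (a.2 : ℕ) b.2 ∨
        (min (c.2 : ℕ) d.2 = min (a.2 : ℕ) b.2 ∧ max (c.2 : ℕ) d.2 < max (a.2 : ℕ) b.2)))

/-- The relation `≫` in terms of halves. -/
def Gg : Piece n → Piece n → Prop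
  | two a b, two c d => Tri (two a b) (two c d) ∨
      ((max (c.2 : ℕ) d.2 < min (a.2 : ℕ) b.2 ∨
        (min (a.2 : ℕ) b.2 < min (c.2 : ℕ) d.2 ∧ max (c.2 : ℕ) d.2 < max (a.2 : ℕ) b.2)) ∧
      (c.1 + d.1 < a.1 + b.1 ∨ (c.1 + d.1 = a.1 + b.1 ∧
      (min (c.2 : ℕ) d.2 < min (a.2 : ℕ) b.2 ∨
        (min (c.2 : ℕ) d.2 = min (a.2 : ℕ) b.2 ∧ max (c.2 : ℕ) d.2 < max (a.2 : ℕ) b.2)))))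
  | p, q => Tri p q

instance (p q : Piece n) : Decidable (Tri p q) := by
  cases p <;> cases q <;> unfold Tri <;> infer_instance

/-- The pieces that represent elements of `𝒫 ⊔ 𝒮`. -/
def IsPart : Piece n → Prop
  | one a => 1 ≤ a.1
  | two a b => Linked a b ∧ 1 ≤ b.1

theorem Gg.of_tri {p q : Piece n} (h : Tri p q) : Gg p q := by
  cases p <;> cases q <;> first | exact h | exact Or.inl h

theorem IsPart.raise {p : Piece n} (h : p.IsPart) : p.raise.IsPart := by
  rcases p with a | ⟨a, b⟩ <;>
    simp only [IsPart, Piece.raise, Linked, Above, raise_fst, raise_snd] at * <;> omega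

theorem Gg.raise {p q : Piece n} (h : Gg p q) : Gg p.raise q.raise := by
  rcases p with a | ⟨a, b⟩ <;> rcases q with c | ⟨c, d⟩ <;>
    simp only [Gg, Tri, Piece.raise, raise_fst, raise_snd] at * <;> omega

theorem Gg.of_raise {a b : ℤ × Fin n} {q : Piece n} (h : Gg (two a b) q.raise) :
    Gg (two b (lower a)) q := by
  rcases q with c | ⟨c, d⟩ <;>
    simp only [Gg, Tri, Piece.raise, raise_fst, raise_snd, lower_fst, lower_snd] at * <;> omega

end Piece

open Piece

/-! ### Insertion and extraction -/

/-- Inserts a secondary part with halves `a`, `b` to the left of a sequence of primary parts: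
it moves to the right until it splits into its halves. -/
def insertTwo (a b : ℤ × Fin n) : List (ℤ × Fin n) → List (ℤ × Fin n)
  | [] => [a, b]
  | l :: M => if Above b l then a :: b :: l :: M else raise l :: insertTwo b (lower a) M

def insertPiece : Piece n → List (ℤ × Fin n) → List (ℤ × Fin n)
  | one a, L => a :: L
  | two a b, L => insertTwo a b L

/-- The inverse of `insertPiece`: splits off the first part of the image in `ℰ`. -/
def extract (a : ℤ × Fin n) : List (ℤ × Fin n) → Piece n × List (ℤ × Fin n)
  | [] => (one a, [])
  | b :: R =>
      if Linked a b then (two a b, R)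
      else if Tri (one a) (extract b R).1 then (one a, b :: R)
      else ((extract b R).1.raise, lower a :: (extract b R).2)

/-- Sequences in `𝒪`. -/
def IsDistinct (L : List (ℤ × Fin n)) : Prop := L.IsChain Above ∧ ∀ a ∈ L, 1 ≤ a.1

/-- The condition for `p` to be split off from `insertPiece p L`. -/
def Valid (p : Piece n) : List (ℤ × Fin n) → Prop
  | [] => True
  | m :: M => Gg p (extract m M).1 ∧ Tri p (one m)

theorem isDistinct_cons_cons {a b : ℤ × Fin n} {L : List (ℤ × Fin n)} :
    IsDistinct (a :: b :: L) ↔ Above a b ∧ 1 ≤ a.1 ∧ IsDistinct (b :: L) := by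
  simp only [IsDistinct, List.isChain_cons_cons, List.forall_mem_cons]; tauto

theorem IsDistinct.tail {a : ℤ × Fin n} {L : List (ℤ × Fin n)} (h : IsDistinct (a :: L)) :
    IsDistinct L :=
  ⟨h.1.tail, fun x hx => h.2 x (List.mem_cons_of_mem _ hx)⟩

theorem isDistinct_nil : IsDistinct ([] : List (ℤ × Fin n)) := ⟨.nil, by simp⟩

theorem isDistinct_singleton {a : ℤ × Fin n} : IsDistinct [a] ↔ 1 ≤ a.1 := by
  simp [IsDistinct]

theorem IsDistinct.one_le {a : ℤ × Fin n} {L : List (ℤ × Fin n)} (h : IsDistinct (a :: L)) :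
    1 ≤ a.1 := h.2 a (by simp)

/-- What `extract` returns, and that `insertPiece` reverts it. -/
theorem extract_spec (T : List (ℤ × Fin n)) : ∀ a : ℤ × Fin n, IsDistinct (a :: T) →
    (extract a T).1.IsPart ∧ IsDistinct (extract a T).2 ∧
    insertPiece (extract a T).1 (extract a T).2 = a :: T ∧
    (extract a T).2.length ≤ T.length ∧
    ((extract a T).1 = one a ∨
      (∃ b R, T = b :: R ∧ Linked a b ∧ (extract a T).1 = two a b) ∨
      (∃ c d, (extract a T).1 = two c d ∧ ¬ Above (raise d) a)) ∧
    Valid (extract a T).1 (extract a T).2 := by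
  induction hk : T.length using Nat.strong_induction_on generalizing T with
  | _ k ih' =>
  subst hk
  have ih := fun S (hS : S.length < T.length) => ih' S.length hS S rfl
  clear ih'
  rcases T with _ | ⟨b, R⟩
  · intro a h; simp [extract, IsPart, isDistinct_nil, insertPiece, Valid, h.one_le]
  intro a h
  obtain ⟨hab, ha1, hb⟩ := isDistinct_cons_cons.1 h
  obtain ⟨ih1, ih2, ih3, ih4, -, ih6⟩ := ih R (by simp) b hb
  rw [extract]
  split_ifs with hl ht
  · refine ⟨⟨hl, hb.one_le⟩, hb.tail, ?_, by simp, .inr (.inl ⟨b, R, rfl, hl, rfl⟩), ?_⟩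
    · cases R with
      | nil => rfl
      | cons r R' => simp [insertPiece, insertTwo, (isDistinct_cons_cons.1 hb).1]
    · cases R with
      | nil => trivial
      | cons r R' =>
        have hbr := (isDistinct_cons_cons.1 hb).1
        have hr1 := hb.tail.one_le
        -- The next extracted piece is `r`, a pair starting with `r`, or a pair whose lower half
        -- plus 1 is not above `r`. In each case this bounds it enough for `≫`.
        obtain ⟨j1, -, -, -, j5, -⟩ := ih R' (by simp) r hb.tail
        refine ⟨?_, ?_⟩
        · rcases j5 with h5 | ⟨r', R'', rfl, hr, h5⟩ | ⟨c, d, h5, hd⟩ <;> rw [h5] at j1 ⊢ <;>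
            simp only [Linked, Above, Gg, Tri, raise_fst, raise_snd, IsPart] at * <;> omega
        · simp only [Linked, Above, Tri, raise_fst, raise_snd] at *; omega
  · refine ⟨ha1, hb, rfl, by simp, .inl rfl, Gg.of_tri ht, ?_⟩
    simp only [Linked, Above, Tri, raise_fst, raise_snd] at *; omega
  · generalize extract b R = e at *
    obtain ⟨y, T'⟩ := e
    rcases y with y | ⟨c, d⟩
    -- An extracted primary part would be `b` itself, and `a ≻ b` without a link already means `a ▷
    -- b`.
    · obtain ⟨rfl, rfl⟩ : y = b ∧ T' = R := by simpa [insertPiece] using ih3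
      simp only [Linked, Above, Tri, raise_fst, raise_snd] at *; omega
    simp only [insertPiece] at ih3
    -- The raised piece has halves `d + 1`, `c`. The first clause makes it cross `a - 1` again and
    -- restore `a`; the others keep the remainder distinct and give `≫` when `a - 1` is linked to
    -- its successor.
    have key : ¬ Above c (lower a) ∧ 1 ≤ (lower a).1 ∧ (∀ m M, T' = m :: M →
        Above (lower a) m ∧ (Linked (lower a) m → Above d m)) := by
      rcases T' with _ | ⟨m, M⟩
      · obtain ⟨rfl, rfl⟩ : c = b ∧ [d] = R := by simpa [insertTwo] using ih3
        refine ⟨?_, ?_, by simp⟩ <;>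
        simp only [Linked, Above, raise_fst, raise_snd, lower_fst, lower_snd, IsPart] at * <;> omega
      · have hm1 := ih2.one_le
        by_cases hdm : Above d m
        · obtain ⟨rfl, -⟩ : c = b ∧ d :: m :: M = R := by simpa [insertTwo, hdm] using ih3
          refine ⟨?_, ?_, ?_⟩
          · simp only [Linked, Above, raise_fst, raise_snd, lower_fst, lower_snd, IsPart] at *
            omega
          · simp only [Linked, Above, raise_fst, raise_snd, lower_fst, lower_snd, IsPart] at *
            omega
          · rintro _ _ ⟨⟩
            simp only [Linked, Above, raise_fst, raise_snd, lower_fst, lower_snd, IsPart] at *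
            omega
        · obtain ⟨rfl, -⟩ : raise m = b ∧ insertTwo d (lower c) M = R := by
            simpa [insertTwo, hdm] using ih3
          refine ⟨?_, ?_, ?_⟩
          · simp only [Linked, Above, raise_fst, raise_snd, lower_fst, lower_snd, IsPart] at *
            omega
          · simp only [Linked, Above, raise_fst, raise_snd, lower_fst, lower_snd, IsPart] at *
            omega
          · rintro _ _ ⟨⟩
            simp only [Linked, Above, raise_fst, raise_snd, lower_fst, lower_snd, IsPart] at *
            omega
    obtain ⟨k1, k2, k3⟩ := key
    refine ⟨ih1.raise, ?_, ?_, by simp at ih4 ⊢; omega, .inr (.inr ⟨_, _, rfl, ?_⟩), ?_, ?_⟩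
    · rcases T' with _ | ⟨m, M⟩
      · exact isDistinct_singleton.2 k2
      · exact isDistinct_cons_cons.2 ⟨(k3 m M rfl).1, k2, ih2⟩
    · simp [insertPiece, Piece.raise, insertTwo, k1, ih3]
    · simp only [Above, raise_fst, raise_snd, lower_fst, lower_snd] at *
      omega
    · rcases T' with _ | ⟨m, M⟩
      · simp only [extract, Piece.raise, Linked, Above, Gg, Tri, raise_fst, raise_snd, lower_fst,
          lower_snd, IsPart] at *
        omega
      · obtain ⟨k3, k4⟩ := k3 m M rfl
        rw [extract]
        split_ifs with hl' ht'
        · have k4 := k4 hl'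
          simp only [Piece.raise, Linked, Above, Gg, Tri, raise_fst, raise_snd, lower_fst,
            lower_snd, IsPart] at *
          omega
        · simp only [Piece.raise, Gg, Tri, raise_fst, raise_snd, lower_fst, lower_snd] at *
          omega
        -- Both consecutive pieces have crossed one entry, so their relation is that of the
        -- induction hypothesis, shifted by 1.
        · exact Gg.raise ih6.1
    · simp only [Tri, Piece.raise, raise_fst, raise_snd, lower_fst, lower_snd] at *
      omega

/-! ### Extraction undoes insertion -/

/-- The alternatives correspond to even and odd size of the glued part. -/
theorem linked_iff {a b : ℤ × Fin n} :
    Linked a b ↔ a.1 = b.1 ∧ (b.2 : ℕ) < a.2 ∨ a.1 = b.1 + 1 ∧ (a.2 : ℕ) < b.2 := by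
  simp only [Linked, Above, raise_fst, raise_snd]; omega

section

variable {a b l m : ℤ × Fin n}

/-- This lemma and the next two serve `Valid.two_lower` when `l` and `m` are linked: the part facing
`two a b` is then `two l m`, but after crossing `l` it faces whatever is extracted from the list
starting with `m`. They cover the possible shapes listed in `extract_spec`. -/
theorem tri_lower_one_of_linked (hp : (two a b).IsPart) (hl : ¬ Above b l) (hlm : Linked l m)
    (h1 : 1 ≤ l.1) (hm : 1 ≤ m.1) (hg : Gg (two a b) (two l m)) (ht : Tri (two a b) (one l)) :
    Tri (two b (lower a)) (one m) := by
  obtain ⟨hp, -⟩ := hp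
  rw [linked_iff] at hp hlm
  simp only [Above, Gg, Tri, lower_fst, lower_snd] at *
  rcases hp with hp | hp <;> rcases hlm with hlm | hlm <;> rcases hg with hg | hg <;> omega

theorem gg_lower_of_linked (hp : (two a b).IsPart) (hl : ¬ Above b l) (hlm : Linked l m)
    (hg : Gg (two a b) (two l m)) {c : ℤ × Fin n} (hc : Linked m c) :
    Gg (two b (lower a)) (two m c) := by
  obtain ⟨hp, -⟩ := hp
  rw [linked_iff] at hp hlm hc
  simp only [Above, Gg, Tri, lower_fst, lower_snd] at *
  rcases hp with hp | hp <;> rcases hlm with hlm | hlm <;> rcases hc with hc | hc <;>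
  rcases hg with hg | hg <;> omega

theorem gg_lower_of_linked_of_not_above (hp : (two a b).IsPart) (hl : ¬ Above b l)
    (hlm : Linked l m) (hg : Gg (two a b) (two l m)) {c d : ℤ × Fin n} (hc : Linked c d)
    (hd : ¬ Above (raise d) m) : Gg (two b (lower a)) (two c d) := by
  obtain ⟨hp, -⟩ := hp
  rw [linked_iff] at hp hlm hc
  simp only [Above, Gg, Tri, lower_fst, lower_snd, raise_fst, raise_snd] at *
  rcases hp with hp | hp <;> rcases hlm with hlm | hlm <;> rcases hc with hc | hc <;>
  rcases hg with hg | hg <;> omega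

/-- If both `l` and `m` are crossed, their raised copies stay linked and would be extracted
prematurely; `≫` rules this out. -/
theorem not_gg_of_linked (hp : (two a b).IsPart) (hl : ¬ Above b l)
    (hlm : Linked l m) (hm : ¬ Above (lower a) m) : ¬ Gg (two a b) (two l m) := by
  intro hg
  obtain ⟨hp, -⟩ := hp
  rw [linked_iff] at hp hlm
  simp only [Above, Gg, Tri, lower_fst, lower_snd, raise_fst, raise_snd] at *
  rcases hp with hp | hp <;> rcases hlm with hlm | hlm <;> rcases hg with hg | hg <;> omega

end

/-- The invariant of insertion: after a crossing, the diminished part is valid for the rest of the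
list and its new lower half is still positive. -/
theorem Valid.two_lower {a b l : ℤ × Fin n} {M : List (ℤ × Fin n)} (hp : (two a b).IsPart)
    (hl : ¬ Above b l) (hM : IsDistinct (l :: M)) (h : Valid (two a b) (l :: M)) :
    Valid (two b (lower a)) M ∧ 1 ≤ (lower a).1 := by
  obtain ⟨h1, h2⟩ := h
  have hl1 := hM.one_le
  refine ⟨?_, ?_⟩
  · rcases M with _ | ⟨m, M⟩
    · trivial
    obtain ⟨hlm, -, hm⟩ := isDistinct_cons_cons.1 hM
    have hm1 := hm.one_le
    obtain ⟨s1, s2, s3, s4, s5, s6⟩ := extract_spec M m hm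
    rw [extract] at h1
    split_ifs at h1 with h3 h4
    · have := tri_lower_one_of_linked hp hl h3 hl1 hm1 h1 h2
      refine ⟨?_, this⟩
      rcases s5 with h5 | ⟨r', R'', rfl, hr, h5⟩ | ⟨c, d, h5, hd⟩ <;> rw [h5] at s1 ⊢
      · exact this
      · exact gg_lower_of_linked hp hl h3 h1 hr
      · exact gg_lower_of_linked_of_not_above hp hl h3 h1 s1.1 hd
    · refine ⟨Gg.of_tri ?_, ?_⟩
      · generalize (extract m M).1 = u at *
        rcases u with u | ⟨c, d⟩ <;>
        simp only [Linked, Above, Tri, raise_fst, raise_snd, lower_fst, lower_snd, IsPart] at * <;>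
        omega
      · simp only [Linked, Above, Tri, raise_fst, raise_snd, lower_fst, lower_snd, IsPart] at *
        omega
    · refine ⟨h1.of_raise, ?_⟩
      simp only [Linked, Above, Tri, raise_fst, raise_snd, lower_fst, lower_snd, IsPart] at *
      omega
  · simp only [Linked, Above, Tri, raise_fst, raise_snd, lower_fst, lower_snd, IsPart] at *
    omega

theorem insertTwo_eq_cons (a b : ℤ × Fin n) (L : List (ℤ × Fin n)) :
    ∃ x T, insertTwo a b L = x :: T ∧
      (x = a ∨ ∃ m M, L = m :: M ∧ ¬ Above b m ∧ x = raise m) := by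
  rcases L with _ | ⟨m, M⟩
  · exact ⟨a, [b], rfl, .inl rfl⟩
  · by_cases h : Above b m
    · exact ⟨a, b :: m :: M, by simp [insertTwo, h], .inl rfl⟩
    · exact ⟨raise m, insertTwo b (lower a) M, by simp [insertTwo, h], .inr ⟨m, M, rfl, h, rfl⟩⟩

/-- Induction on the list. After a crossing, extraction must neither glue `raise l` to its successor
(excluded by the `≫` half of validity) nor keep `raise l` as a primary part (excluded by the `▷`
half). -/
theorem extract_insertTwo (L : List (ℤ × Fin n)) : ∀ a b : ℤ × Fin n, (two a b).IsPart →
    IsDistinct L → Valid (two a b) L → ∃ x T, insertTwo a b L = x :: T ∧ IsDistinct (x :: T) ∧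
      extract x T = (two a b, L) := by
  induction L with
  | nil =>
    intro a b hp _ _
    refine ⟨a, [b], rfl, isDistinct_cons_cons.2 ⟨hp.1.1, ?_, isDistinct_singleton.2 hp.2⟩, ?_⟩
    · simp only [Linked, Above, IsPart] at *; omega
    · simp [extract, hp.1]
  | cons l M ih =>
    intro a b hp hL hv
    by_cases hbl : Above b l
    · refine ⟨a, b :: l :: M, by simp [insertTwo, hbl],
        isDistinct_cons_cons.2 ⟨hp.1.1, ?_, isDistinct_cons_cons.2 ⟨hbl, hp.2, hL⟩⟩, ?_⟩
      · simp only [Linked, Above, IsPart] at *; omega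
      · simp [extract, hp.1]
    · obtain ⟨h1, h2⟩ := hv.two_lower hp hbl hL
      have hp' : (two b (lower a)).IsPart := by
        simp only [Linked, Above, IsPart, raise_fst, raise_snd, lower_fst, lower_snd] at *; omega
      obtain ⟨x, T, e1, e2, e3⟩ := ih b (lower a) hp' hL.tail h1
      have hx : x = b ∨ ∃ m M', M = m :: M' ∧ ¬ Above (lower a) m ∧ x = raise m := by
        obtain ⟨x', T', e, hx⟩ := insertTwo_eq_cons b (lower a) M
        rw [e1] at e
        obtain ⟨rfl, -⟩ := List.cons.inj e
        exact hx
      refine ⟨raise l, x :: T, by simp [insertTwo, hbl, e1], ?_, ?_⟩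
      · refine isDistinct_cons_cons.2 ⟨?_, ?_, e2⟩
        · rcases hx with rfl | ⟨m, M, rfl, -, rfl⟩
          · simp only [Above, raise_fst, raise_snd] at *; omega
          · have := (isDistinct_cons_cons.1 hL).1
            simp only [Above, raise_fst, raise_snd] at *; omega
        · have := hL.one_le
          rw [raise_fst]; omega
      · have k1 : ¬ Linked (raise l) x := by
          rcases hx with rfl | ⟨m, M, rfl, hm, rfl⟩
          · simp only [Linked, Above, raise_fst, raise_snd] at *; omega
          · intro hlm
            replace hlm : Linked l m := by
              simp only [Linked, Above, raise_fst, raise_snd] at hlm ⊢; omega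
            have hg := hv.1
            rw [extract, if_pos hlm] at hg
            exact not_gg_of_linked hp hbl hlm hm hg
        have k2 : ¬ Tri (one (raise l)) (two b (lower a)) := by
          have := hv.2
          simp only [Tri, raise_fst, raise_snd, lower_fst, lower_snd] at *; omega
        simp [extract, e3, k1, k2, Piece.raise]

/-- `extract` inverts `insertPiece` on valid pairs. -/
theorem extract_insertPiece {p : Piece n} {L : List (ℤ × Fin n)} (hp : p.IsPart)
    (hL : IsDistinct L) (hv : Valid p L) : ∃ x T, insertPiece p L = x :: T ∧
      IsDistinct (x :: T) ∧ extract x T = (p, L) := by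
  rcases p with a | ⟨a, b⟩
  · refine ⟨a, L, rfl, ?_⟩
    rcases L with _ | ⟨l, M⟩
    · exact ⟨isDistinct_singleton.2 hp, rfl⟩
    · obtain ⟨h1, h2⟩ := hv
      have h3 : ¬ Linked a l := by
        simp only [Linked, Above, Tri, raise_fst, raise_snd] at *; omega
      have h4 : Tri (one a) (extract l M).1 := by
        generalize (extract l M).1 = q at *
        cases q <;> exact h1
      refine ⟨isDistinct_cons_cons.2 ⟨?_, hp, hL⟩, by simp [extract, h3, h4]⟩
      simp only [Above, Tri] at *; omega
  · exact extract_insertTwo L a b hp hL hv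

/-! ### The bijection on sequences of pieces -/

/-- The image in `𝒪` of a sequence of pieces: they are inserted one by one, from the right. -/
def build (L : List (Piece n)) : List (ℤ × Fin n) := L.foldr insertPiece []

@[simp] theorem build_nil : build ([] : List (Piece n)) = [] := rfl

@[simp] theorem build_cons (p : Piece n) (L : List (Piece n)) :
    build (p :: L) = insertPiece p (build L) := rfl

/-- The sequences in which every insertion can be reverted by `extract`. -/
def Good : List (Piece n) → Prop
  | [] => True
  | p :: L => p.IsPart ∧ Good L ∧ (∀ q ∈ L.head?, Gg p q) ∧
      ∀ m ∈ (build L).head?, Tri p (one m)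

theorem Good.build_spec {L : List (Piece n)} (h : Good L) : IsDistinct (build L) ∧
    ∀ p M, L = p :: M → ∃ x T, build L = x :: T ∧ extract x T = (p, build M) := by
  induction L with
  | nil => exact ⟨isDistinct_nil, by simp⟩
  | cons p M ih =>
    obtain ⟨h1, h2, h3, h4⟩ := h
    obtain ⟨ih1, ih2⟩ := ih h2
    have hv : Valid p (build M) := by
      rcases M with _ | ⟨q, M'⟩
      · trivial
      · obtain ⟨x, T, e1, e2⟩ := ih2 q M' rfl
        rw [e1] at h4 ⊢
        exact ⟨by simpa [e2] using h3, by simpa using h4⟩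
    obtain ⟨x, T, e1, e2, e3⟩ := extract_insertPiece h1 ih1 hv
    refine ⟨by rw [build_cons, e1]; exact e2, ?_⟩
    rintro _ _ ⟨⟩
    exact ⟨x, T, e1, e3⟩

theorem Good.eq_of_build_eq {L : List (Piece n)} : ∀ {M : List (Piece n)}, Good L → Good M →
    build L = build M → L = M := by
  induction L with
  | nil =>
    intro M _ hM h
    rcases M with _ | ⟨q, M⟩
    · rfl
    · obtain ⟨x, T, e, -⟩ := hM.build_spec.2 q M rfl
      simp [e] at h
  | cons p L ih =>
    intro M hL hM h
    obtain ⟨x, T, e1, e2⟩ := hL.build_spec.2 p L rfl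
    rcases M with _ | ⟨q, M⟩
    · simp [e1] at h
    · obtain ⟨y, U, e3, e4⟩ := hM.build_spec.2 q M rfl
      obtain ⟨rfl, rfl⟩ : x = y ∧ T = U := by rw [← List.cons.injEq, ← e1, ← e3, h]
      obtain ⟨rfl, h'⟩ : p = q ∧ build L = build M := by
        rw [← Prod.mk.injEq, ← e2, ← e4]
      rw [ih hL.2.1 hM.2.1 h']

/-- Iterated extraction terminates because the remainder is strictly shorter than the list. -/
theorem exists_good_build_eq (L : List (ℤ × Fin n)) (hL : IsDistinct L) :
    ∃ M, Good M ∧ build M = L := by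
  induction hk : L.length using Nat.strong_induction_on generalizing L with
  | _ k ih =>
  subst hk
  rcases L with _ | ⟨a, T⟩
  · exact ⟨[], trivial, rfl⟩
  · obtain ⟨h1, h2, h3, h4, -, h6⟩ := extract_spec T a hL
    obtain ⟨M, hM, hb⟩ := ih _ (by simp; omega) _ h2 rfl
    refine ⟨(extract a T).1 :: M, ⟨h1, hM, ?_, ?_⟩, by rw [build_cons, hb, h3]⟩
    · rcases M with _ | ⟨q, M⟩
      · simp
      · obtain ⟨x, U, e1, e2⟩ := hM.build_spec.2 q M rfl
        rw [← hb, e1] at h6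
        simpa [e2] using h6.1
    · intro m hm
      rw [hb] at hm
      rcases h : (extract a T).2 with _ | ⟨l, N⟩
      · simp [h] at hm
      · rw [h] at hm h6
        simp at hm
        exact hm ▸ h6.2

/-! ### Preservation of size and color product -/

/-- Size and color product. -/
noncomputable def weight (a : ℤ × Fin n) : ℤ × (Fin n →₀ ℕ) := (a.1, Finsupp.single a.2 1)

noncomputable def Piece.weight : Piece n → ℤ × (Fin n →₀ ℕ)
  | one a => Goellnitz.weight a
  | two a b => Goellnitz.weight a + Goellnitz.weight b

theorem weight_raise (a : ℤ × Fin n) : weight (raise a) = weight a + (1, 0) := by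
  simp [weight]

theorem weight_insertTwo (L : List (ℤ × Fin n)) : ∀ a b : ℤ × Fin n,
    ((insertTwo a b L).map weight).sum = weight a + weight b + (L.map weight).sum := by
  induction L with
  | nil => intro a b; simp [insertTwo]
  | cons l M ih =>
    intro a b
    rw [insertTwo]
    split_ifs
    · simp [add_assoc]
    · have := weight_raise (lower a)
      rw [raise_lower] at this
      rw [List.map_cons, List.sum_cons, ih, weight_raise, this, List.map_cons, List.sum_cons]
      abel

theorem weight_build (L : List (Piece n)) :
    ((build L).map weight).sum = (L.map Piece.weight).sum := by
  induction L with
  | nil => rfl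
  | cons p L ih =>
    rcases p with a | ⟨a, b⟩
    · simp [insertPiece, ih, Piece.weight]
    · simp [insertPiece, ih, Piece.weight, weight_insertTwo]

/-! ### Colored numbers as pieces -/

/-- A colored number of secondary color is decomposed into its halves. -/
def halves : ColoredNumber n → Piece n
  | ⟨k, .primary i⟩ => one (k, i)
  | ⟨k, .secondary i j _⟩ =>
      if k % 2 = 0 then two (k / 2, j) (k / 2, i) else two (k / 2 + 1, i) (k / 2, j)

/-- The first component of the key of a color. -/
def Color.lo : Color n → ℕ
  | .primary i => i
  | .secondary i _ _ => i

/-- The second component of the key of a color. -/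
def Color.hi : Color n → ℕ
  | .primary _ => n
  | .secondary _ j _ => j

theorem Color.le_iff {p q : Color n} : p ≤ q ↔ p.lo < q.lo ∨ (p.lo = q.lo ∧ p.hi ≤ q.hi) := by
  refine (Prod.Lex.le_iff ..).trans ?_
  cases p <;> cases q <;> rfl

theorem succ_iff {x y : ColoredNumber n} : x.Succ y ↔ y.size < x.size ∨ (y.size = x.size ∧
    (y.color.lo < x.color.lo ∨ (y.color.lo = x.color.lo ∧ y.color.hi < x.color.hi))) := by
  unfold ColoredNumber.Succ
  split_ifs with h <;> rw [Color.le_iff] at h <;> omega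

theorem tri_halves_iff (x y : ColoredNumber n) : (halves x).Tri (halves y) ↔ x.Tri y := by
  obtain ⟨k, i | ⟨i, j, hij⟩⟩ := x <;> obtain ⟨l, r | ⟨r, s, hrs⟩⟩ := y <;>
  simp only [halves, ColoredNumber.Tri, ColoredNumber.SuccEq, succ_iff, Color.IsPrimary,
    ColoredNumber.shift, Color.lo, Color.hi, ColoredNumber.mk.injEq, Color.primary.injEq,
    Fin.ext_iff, reduceCtorEq, or_true, true_or, or_self, not_true_eq_false, not_false_eq_true,
    false_and, and_false, and_self, forall_const, false_imp_iff, and_true, true_and, or_false]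
  all_goals try split_ifs
  all_goals simp only [Tri]
  all_goals omega

theorem gg_halves_iff (x y : ColoredNumber n) : (halves x).Gg (halves y) ↔ x.Gg y := by
  obtain ⟨k, i | ⟨i, j, hij⟩⟩ := x <;> obtain ⟨l, r | ⟨r, s, hrs⟩⟩ := y <;>
  simp only [halves, ColoredNumber.Gg, ColoredNumber.SuccEq, succ_iff, Color.IsPrimary,
    Color.IsSpecialPair,
    ColoredNumber.shift, Color.lo, Color.hi, ColoredNumber.mk.injEq, Color.primary.injEq,
    Fin.ext_iff, reduceCtorEq, or_true, true_or, or_self, not_true_eq_false, not_false_eq_true,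
    false_and, and_false, and_self, forall_const, false_imp_iff, and_true, true_and, or_false]
  all_goals try split_ifs
  all_goals simp only [Gg, Tri]
  all_goals omega

theorem isPart_halves_iff (x : ColoredNumber n) :
    (halves x).IsPart ↔ x.IsPrimaryPart ∨ x.IsSecondaryPart := by
  obtain ⟨k, i | ⟨i, j, hij⟩⟩ := x
  · simp [halves, IsPart, ColoredNumber.IsPrimaryPart, ColoredNumber.IsSecondaryPart,
      Color.IsPrimary]
  · simp only [halves, ColoredNumber.IsPrimaryPart, ColoredNumber.IsSecondaryPart,
      Color.IsPrimary, false_and, false_or, not_false_eq_true, true_and]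
    split_ifs <;> simp only [IsPart, linked_iff, true_and] <;> omega

theorem weight_halves (x : ColoredNumber n) :
    (halves x).weight = (x.size, x.color.product) := by
  obtain ⟨k, i | ⟨i, j, hij⟩⟩ := x
  · rfl
  · simp only [halves]
    split_ifs <;> simp only [Piece.weight, weight, Color.product, Prod.mk_add_mk, Prod.mk.injEq]
    · exact ⟨by omega, add_comm _ _⟩
    · exact ⟨by omega, trivial⟩

theorem halves_injective : Function.Injective (halves (n := n)) := by
  rintro ⟨k, i | ⟨i, j, hij⟩⟩ ⟨l, r | ⟨r, s, hrs⟩⟩ <;> simp only [halves]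
  · simp
  · split_ifs <;> simp
  · split_ifs <;> simp
  · split_ifs <;> simp [Fin.ext_iff] <;> omega

theorem exists_halves_eq {p : Piece n} (hp : p.IsPart) : ∃ x, halves x = p := by
  rcases p with ⟨k, i⟩ | ⟨⟨k, i⟩, ⟨l, j⟩⟩
  · exact ⟨⟨k, .primary i⟩, rfl⟩
  · rcases linked_iff.1 hp.1 with ⟨h1, h2⟩ | ⟨h1, h2⟩ <;> simp only at h1 h2
    · refine ⟨⟨k + l, .secondary j i h2⟩, ?_⟩
      simp only [halves]
      split_ifs <;> simp <;> omega
    · refine ⟨⟨k + l, .secondary i j h2⟩, ?_⟩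
      simp only [halves]
      split_ifs <;> simp <;> omega

namespace Piece

/-- The upper half. -/
def upper : Piece n → ℤ × Fin n
  | one a => a
  | two a _ => a

/-- The lower half. -/
def bottom : Piece n → ℤ × Fin n
  | one a => a
  | two _ b => b

def IsOne : Piece n → Prop
  | one _ => True
  | two _ _ => False

end Piece

/-- The primary part `k_p` for `a = (k, p)`. -/
def primaryPart (a : ℤ × Fin n) : ColoredNumber n := ⟨a.1, .primary a.2⟩

/-- `a + t`. -/
def shiftBy (a : ℤ × Fin n) (t : ℤ) : ℤ × Fin n := (a.1 + t, a.2)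

theorem upperHalf_eq (x : ColoredNumber n) : x.upperHalf = primaryPart (halves x).upper := by
  obtain ⟨k, i | ⟨i, j, hij⟩⟩ := x <;> simp only [halves, ColoredNumber.upperHalf]
  · rfl
  · split_ifs <;> rfl

theorem lowerHalf_eq (x : ColoredNumber n) : x.lowerHalf = primaryPart (halves x).bottom := by
  obtain ⟨k, i | ⟨i, j, hij⟩⟩ := x <;> simp only [halves, ColoredNumber.lowerHalf]
  · rfl
  · split_ifs <;> rfl

theorem isOne_halves_iff (x : ColoredNumber n) : (halves x).IsOne ↔ x.color.IsPrimary := by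
  obtain ⟨k, i | ⟨i, j, hij⟩⟩ := x <;> simp only [halves]
  · rfl
  · split_ifs <;> rfl

theorem shift_primaryPart (a : ℤ × Fin n) (t : ℤ) :
    (primaryPart a).shift t = primaryPart (shiftBy a t) := rfl

theorem halves_primaryPart (a : ℤ × Fin n) : halves (primaryPart a) = one a := rfl

theorem succ_primaryPart_iff (a b : ℤ × Fin n) :
    (primaryPart a).Succ (primaryPart b) ↔ Above a b := by
  rw [succ_iff]
  simp only [primaryPart, Color.lo, Color.hi, Above]
  omega

/-- `x ⪰ a + 1` if and only if `x ▷ a`. -/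
theorem succEq_raise_iff (x : ColoredNumber n) (a : ℤ × Fin n) :
    x.SuccEq (primaryPart (raise a)) ↔ (halves x).Tri (one a) := by
  rw [← halves_primaryPart, tri_halves_iff]
  simp only [ColoredNumber.Tri, primaryPart, Color.IsPrimary, or_true, true_imp_iff,
    not_true_eq_false, and_false, false_imp_iff, and_true]
  rfl

/-! ### Bridges and the first entry of the image -/

/-- The sequence in `𝒪` that corresponds to a sequence of parts. -/
def toDistinct (ν : List (ColoredNumber n)) : List (ℤ × Fin n) := build (ν.map halves)

theorem drop_toDistinct {ν : List (ColoredNumber n)} {i : ℕ} (h : i < ν.length) :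
    toDistinct (ν.drop i) = insertPiece (halves ν[i]) (toDistinct (ν.drop (i + 1))) := by
  rw [List.drop_eq_getElem_cons h]; rfl

theorem good_map_halves_iff (ν : List (ColoredNumber n)) : Good (ν.map halves) ↔
    ν ∈ setE n ∧ ∀ (i : ℕ) (h : i < ν.length), ∀ m ∈ (toDistinct (ν.drop (i + 1))).head?,
      (halves ν[i]).Tri (one m) := by
  induction ν with
  | nil => simp [Good, setE]
  | cons x ν ih =>
    have e : (∀ (i : ℕ) (h : i < (x :: ν).length),
        ∀ m ∈ (toDistinct ((x :: ν).drop (i + 1))).head?, (halves (x :: ν)[i]).Tri (one m)) ↔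
        (∀ m ∈ (toDistinct ν).head?, (halves x).Tri (one m)) ∧
        ∀ (i : ℕ) (h : i < ν.length), ∀ m ∈ (toDistinct (ν.drop (i + 1))).head?,
          (halves ν[i]).Tri (one m) := by
      constructor
      · exact fun h => ⟨h 0 (by simp), fun i hi => h (i + 1) (by simpa using hi)⟩
      · rintro ⟨h1, h2⟩ (_ | i) h
        · exact h1
        · exact h2 i (by simpa using h)
    rw [e, List.map_cons, Good, ih, isPart_halves_iff]
    simp only [setE, Set.mem_ofPred_eq, List.isChain_cons, List.forall_mem_cons, toDistinct]
    have : (∀ q ∈ (ν.map halves).head?, (halves x).Gg q) ↔ ∀ y ∈ ν.head?, x.Gg y := by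
      cases ν <;> simp [gg_halves_iff]
    rw [this]
    tauto

/-- The part at position `u` of `ν` does not move when it is inserted. -/
def StopsAt (ν : List (ColoredNumber n)) (u : ℕ) (h : u < ν.length) : Prop :=
  (halves ν[u]).IsOne ∨
    ∀ m ∈ (toDistinct (ν.drop (u + 1))).head?, Above (halves ν[u]).bottom m

theorem reaches_iff {ν : List (ColoredNumber n)} {i u : ℕ} (hu : u < ν.length) :
    Reaches ν i u ↔ ∀ (k : ℕ) (_ : i ≤ k) (h : k < u), ¬ Above (halves ν[k]).bottom
      (shiftBy (halves ν[u]).upper ((u : ℤ) - (k : ℤ) - 1)) := by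
  simp only [Reaches, lowerHalf_eq, upperHalf_eq, shift_primaryPart, succ_primaryPart_iff, hu,
    exists_true_left]

theorem head?_insertPiece_of_isOne {p : Piece n} (h : p.IsOne) (L : List (ℤ × Fin n)) :
    (insertPiece p L).head? = some p.upper := by
  cases p
  · rfl
  · exact h.elim

theorem head?_insertPiece_of_forall {p : Piece n} {L : List (ℤ × Fin n)}
    (h : ∀ m ∈ L.head?, Above p.bottom m) : (insertPiece p L).head? = some p.upper := by
  rcases p with a | ⟨a, b⟩
  · rfl
  · rcases L with _ | ⟨m, M⟩
    · rfl
    · have : Above b m := h m rfl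
      simp [insertPiece, insertTwo, this, upper]

theorem head?_insertPiece_of_not {p : Piece n} {L : List (ℤ × Fin n)} {m : ℤ × Fin n}
    (hp : ¬ p.IsOne) (hm : L.head? = some m) (h : ¬ Above p.bottom m) :
    (insertPiece p L).head? = some (raise m) := by
  rcases p with a | ⟨a, b⟩
  · exact (hp trivial).elim
  · rcases L with _ | ⟨l, M⟩
    · simp at hm
    · obtain rfl : l = m := by simpa using hm
      have : ¬ Above b l := h
      simp [insertPiece, insertTwo, this]

/-- The first part of the image of a tail comes from the upper half of a part that does not move,
and all parts before this one move over it. -/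
theorem exists_stopsAt (ν : List (ColoredNumber n)) (i : ℕ) (hi : i < ν.length) :
    ∃ (u : ℕ) (hu : u < ν.length), i ≤ u ∧ StopsAt ν u hu ∧ Reaches ν i u ∧
      (∀ (k : ℕ) (_ : i ≤ k) (h : k < u), ¬ (halves ν[k]).IsOne) ∧
      (toDistinct (ν.drop i)).head? = some (shiftBy (halves ν[u]).upper ((u : ℤ) - (i : ℤ))) := by
  by_cases hs : StopsAt ν i hi
  · refine ⟨i, hi, le_rfl, hs, (reaches_iff hi).2 (by omega), by omega, ?_⟩
    rw [drop_toDistinct hi]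
    have : shiftBy (halves ν[i]).upper ((i : ℤ) - (i : ℤ)) = (halves ν[i]).upper := by
      simp [shiftBy]
    rw [this]
    rcases hs with h | h
    · exact head?_insertPiece_of_isOne h _
    · exact head?_insertPiece_of_forall h
  · have hs' := hs
    simp only [StopsAt, not_or, not_forall, exists_prop] at hs'
    obtain ⟨h1, m, h2, h3⟩ := hs'
    have hi' : i + 1 < ν.length := by
      by_contra h
      rw [List.drop_eq_nil_of_le (by omega)] at h2
      simp [toDistinct] at h2
    obtain ⟨u, hu, hiu, k1, k2, k3, k4⟩ := exists_stopsAt ν (i + 1) hi'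
    obtain rfl : shiftBy (halves ν[u]).upper ((u : ℤ) - ((i + 1 : ℕ) : ℤ)) = m := by
      rw [Option.mem_def, k4] at h2; simpa using h2
    refine ⟨u, hu, by omega, k1, (reaches_iff hu).2 fun k hk hku => ?_, fun k hk hku => ?_, ?_⟩
    · rcases hk.eq_or_lt with rfl | hk
      · convert h3 using 2
        simp [shiftBy]; omega
      · exact (reaches_iff hu).1 k2 k hk hku
    · rcases hk.eq_or_lt with rfl | hk
      · exact h1
      · exact k3 k hk hku
    · rw [drop_toDistinct hi, head?_insertPiece_of_not h1 h2 h3]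
      simp [raise, shiftBy]; omega
termination_by ν.length - i

theorem bottom_upper {x : ColoredNumber n} (h : ¬ (halves x).IsOne) :
    Above (raise (halves x).bottom) (halves x).upper := by
  obtain ⟨k, i | ⟨i, j, hij⟩⟩ := x
  · exact (h trivial).elim
  · simp only [halves]
    split_ifs <;> simp only [bottom, upper, Above, raise, true_and] <;> omega

/-- Let `v` be the part that supplies the first entry after `i`; the lower half at `i` lies above
that entry. Reaching `w = v` contradicts this directly. For `w < v`, the part at `w` crosses that
entry, so its upper half is too small to be reached from `i`. For `w > v`, the argument restarts at
`v`, which also stops. -/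
theorem not_reaches_of_stopsAt {ν : List (ColoredNumber n)} {i : ℕ} (hi : i < ν.length)
    (h1 : ¬ (halves ν[i]).IsOne) (hs : StopsAt ν i hi) {w : ℕ} (hw : w < ν.length) (hiw : i < w)
    (hp : ∀ (k : ℕ) (_ : i < k) (h : k < w), ¬ (halves ν[k]).IsOne) : ¬ Reaches ν i w := by
  intro hr
  obtain ⟨v, hv, hiv, k1, k2, k3, k4⟩ := exists_stopsAt ν (i + 1) (by omega)
  have ha := hs.resolve_left h1 _ k4
  rcases lt_trichotomy w v with h | rfl | h
  · have a1 := (reaches_iff hv).1 k2 w (by omega) h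
    have a2 := (reaches_iff hw).1 hr i le_rfl hiw
    have a3 := bottom_upper (k3 w (by omega) h)
    simp only [Above, shiftBy, raise] at *
    omega
  · have a2 := (reaches_iff hw).1 hr i le_rfl hiw
    simp only [Above, shiftBy, raise] at *
    omega
  · refine not_reaches_of_stopsAt hv (hp v hiv h) k1 hw h (fun k hk hkw => hp k (by omega) hkw) ?_
    exact (reaches_iff hw).2 fun k hk hkw => (reaches_iff hw).1 hr k (by omega) hkw
termination_by ν.length - i

theorem nextPrimary_spec {ν : List (ColoredNumber n)} {i : ℕ} (hi : i < ν.length) :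
    i < nextPrimary ν i ∧ nextPrimary ν i ≤ ν.length ∧
    (∀ h : nextPrimary ν i < ν.length, (halves ν[nextPrimary ν i]).IsOne) ∧
    ∀ (k : ℕ) (_ : i < k) (h : k < ν.length), k < nextPrimary ν i → ¬ (halves ν[k]).IsOne := by
  have hne : {j | i < j ∧ (j = ν.length ∨ ∃ h : j < ν.length, ν[j].color.IsPrimary)}.Nonempty :=
    ⟨ν.length, hi, .inl rfl⟩
  have hm := Nat.sInf_mem hne
  refine ⟨hm.1, Nat.sInf_le ⟨hi, .inl rfl⟩, fun h => ?_, fun k hk h hlt hone => ?_⟩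
  · exact (isOne_halves_iff _).2 (hm.2.resolve_left h.ne).2
  · exact Nat.notMem_of_lt_sInf hlt ⟨hk, .inr ⟨h, (isOne_halves_iff _).1 hone⟩⟩

theorem bridgeIndex_of_stopsAt {ν : List (ColoredNumber n)} {i : ℕ} (hi : i < ν.length)
    (h1 : ¬ (halves ν[i]).IsOne) (hs : StopsAt ν i hi) : bridgeIndex ν i = i := by
  obtain ⟨s1, s2, s3, s4⟩ := nextPrimary_spec hi
  have hn : ∀ w, i < w → w ≤ nextPrimary ν i → ¬ Reaches ν i w := fun w h h' hr =>
    not_reaches_of_stopsAt hi h1 hs hr.1 h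
      (fun k hk hkw => s4 k hk (hkw.trans hr.1) (by omega)) hr
  rw [bridgeIndex, if_neg (hn _ s1 le_rfl), if_neg]
  rintro ⟨u, hu1, hu2, hu3⟩
  exact hn u hu1 hu2.le hu3

/-- A position beyond `u` reached from `i` would also be reached from `u`, which is impossible for a
secondary part that does not move; so `u` is the last admissible position. -/
theorem bridgeIndex_of_reaches {ν : List (ColoredNumber n)} {i u : ℕ} (hu : u < ν.length)
    (hiu : i < u) (hs : StopsAt ν u hu) (hr : Reaches ν i u)
    (hp : ∀ (k : ℕ) (_ : i < k) (h : k < u), ¬ (halves ν[k]).IsOne) : bridgeIndex ν i = u := by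
  obtain ⟨s1, s2, s3, s4⟩ := nextPrimary_spec (hiu.trans hu)
  have hle : u ≤ nextPrimary ν i := by
    by_contra! h
    exact hp _ s1 h (s3 (h.trans hu))
  rcases hle.eq_or_lt with h | h
  · rw [bridgeIndex, if_pos (h ▸ hr), h]
  · have hn : ∀ w, u < w → w ≤ nextPrimary ν i → ¬ Reaches ν i w := by
      intro w h2 h3 hr'
      refine not_reaches_of_stopsAt hu (s4 u hiu hu h) hs hr'.1 h2
        (fun k hk hkw => s4 k (by omega) (hkw.trans hr'.1) (by omega)) ?_
      exact (reaches_iff hr'.1).2 fun k hk hkw => (reaches_iff hr'.1).1 hr' k (by omega) hkw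
    have hg : IsGreatest {u | i < u ∧ u < nextPrimary ν i ∧ Reaches ν i u} u := by
      refine ⟨⟨hiu, h, hr⟩, fun w hw => ?_⟩
      by_contra! hlt
      exact hn w hlt hw.2.1.le hw.2.2
    rw [bridgeIndex, if_neg (hn _ h le_rfl), if_pos ⟨u, hg.1⟩, hg.csSup_eq]

theorem tri_one_of_above {x : ColoredNumber n} (h1 : ¬ (halves x).IsOne)
    (hx : (halves x).IsPart) {m : ℤ × Fin n} (hm : Above (halves x).bottom m) (hm1 : 1 ≤ m.1) :
    (halves x).Tri (one m) := by
  generalize halves x = p at *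
  rcases p with a | ⟨a, b⟩
  · exact (h1 trivial).elim
  · simp only [IsPart, linked_iff, Above, Tri, bottom] at *
    omega

/-- The part at position `i` is `1`-different-distant from its bridge if and only if it is
`▷` the first part of the image of the tail. -/
theorem differentDistant_iff {ν : List (ColoredNumber n)} {i : ℕ} (hi : i < ν.length)
    (h1 : ¬ (halves ν[i]).IsOne) (hx : (halves ν[i]).IsPart)
    {m : ℤ × Fin n} (hm : (toDistinct (ν.drop (i + 1))).head? = some m) (hm1 : 1 ≤ m.1) :
    (ν[i]).DifferentDistant 1 i (bridgeIndex ν i) (bridge ν i hi) ↔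
      (halves ν[i]).Tri (one m) := by
  by_cases hs : StopsAt ν i hi
  · have hb := bridgeIndex_of_stopsAt hi h1 hs
    -- A part that does not move is its own bridge position, and it exceeds its upper half because
    -- its lower half is positive.
    refine iff_of_true ?_ (tri_one_of_above h1 hx (hs.resolve_left h1 m hm) hm1)
    have e : bridge ν i hi = primaryPart (halves ν[i]).upper := by
      simp only [bridge, hb, upperHalf_eq]
    rw [ColoredNumber.DifferentDistant, e, hb, shift_primaryPart]
    have : shiftBy (halves ν[i]).upper (1 * ((i : ℤ) - (i : ℤ))) =
        raise (lower (halves ν[i]).upper) := by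
      rw [raise_lower]; simp [shiftBy]
    rw [this, succEq_raise_iff]
    generalize halves ν[i] = p at *
    rcases p with a | ⟨a, b⟩
    · exact (h1 trivial).elim
    · simp only [IsPart, linked_iff, Above, Tri, bottom, upper, lower] at *
      omega
  · obtain ⟨u, hu, hiu, k1, k2, k3, k4⟩ := exists_stopsAt ν (i + 1) (by
      by_contra h
      rw [List.drop_eq_nil_of_le (by omega)] at hm
      simp [toDistinct] at hm)
    obtain rfl : shiftBy (halves ν[u]).upper ((u : ℤ) - ((i + 1 : ℕ) : ℤ)) = m := by
      rw [k4] at hm; simpa using hm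
    have hr : Reaches ν i u := (reaches_iff hu).2 fun k hk hku => by
      rcases hk.eq_or_lt with rfl | hk
      · intro ha
        refine hs (.inr fun m hm' => ?_)
        rw [Option.mem_def, hm, Option.some_inj] at hm'
        rw [← hm']
        convert ha using 2
        omega
      · exact (reaches_iff hu).1 k2 k hk hku
    have hb := bridgeIndex_of_reaches hu hiu k1 hr k3
    have e : bridge ν i hi = primaryPart (halves ν[u]).upper := by
      simp only [bridge, hb, upperHalf_eq]
    rw [ColoredNumber.DifferentDistant, e, hb, shift_primaryPart, ← succEq_raise_iff]
    -- The distance to the bridge is counted from `i`, the crossings of the tail from `i + 1`; the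
    -- extra 1 turns `⪰` into `▷`.
    have : shiftBy (halves ν[u]).upper (1 * ((u : ℤ) - (i : ℤ))) =
        raise (shiftBy (halves ν[u]).upper ((u : ℤ) - ((i + 1 : ℕ) : ℤ))) := by
      simp [shiftBy, raise]; omega
    rw [this]

theorem isOne_of_gg_of_not_tri {x y : ColoredNumber n} (h : x.Gg y) (h' : ¬ x.Tri y) :
    ¬ (halves x).IsOne ∧ ¬ (halves y).IsOne := by
  rw [← gg_halves_iff] at h
  rw [← tri_halves_iff] at h'
  generalize halves x = p at *
  generalize halves y = q at *
  cases p <;> cases q <;> simp [IsOne] <;> exact h' h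

/-! ### Propagation of the bridge condition -/

/-- The new first entry is either the upper half of `q`, smaller than `q`, or `m + 1` with `q ▷ m`;
being `▷ q` suffices in both cases. -/
theorem tri_head_of_tri {p q : Piece n} {L : List (ℤ × Fin n)} (h : Tri p q)
    (hp : p.IsPart) (hq : q.IsPart) (hL : ∀ m ∈ L.head?, Tri q (one m)) :
    ∀ m ∈ (insertPiece q L).head?, Tri p (one m) := by
  intro m hm
  by_cases h1 : q.IsOne
  · rw [head?_insertPiece_of_isOne h1, Option.mem_some_iff] at hm
    subst hm
    rcases q with a | ⟨a, b⟩
    · exact h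
    · exact h1.elim
  · by_cases h2 : ∀ m ∈ L.head?, Above q.bottom m
    · rw [head?_insertPiece_of_forall h2, Option.mem_some_iff] at hm
      subst hm
      rcases q with a | ⟨a, b⟩
      · exact h
      · rcases p with c | ⟨c, d⟩ <;>
          simp only [IsPart, linked_iff, upper, Tri] at * <;> omega
    · push Not at h2
      obtain ⟨l, h3, h4⟩ := h2
      have h5 := hL l h3
      rw [head?_insertPiece_of_not h1 h3 h4, Option.mem_some_iff] at hm
      subst hm
      rcases q with a | ⟨a, b⟩
      · exact (h1 trivial).elim
      · rcases p with c | ⟨c, d⟩ <;>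
          simp only [IsPart, linked_iff, Tri, raise_fst, raise_snd] at * <;> omega

theorem isPart_of_mem_setE {ν : List (ColoredNumber n)} (h : ν ∈ setE n) {i : ℕ}
    (hi : i < ν.length) : (halves ν[i]).IsPart :=
  (isPart_halves_iff _).2 (h.2 _ (List.getElem_mem hi))

theorem lt_length_of_mem_head? {ν : List (ColoredNumber n)} {i : ℕ} {m : ℤ × Fin n}
    (hm : m ∈ (toDistinct (ν.drop i)).head?) : i < ν.length := by
  by_contra h
  rw [List.drop_eq_nil_of_le (by omega)] at hm
  simp [toDistinct] at hm

theorem one_le_of_mem_head? {ν : List (ColoredNumber n)} (h : ν ∈ setE n) {i : ℕ}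
    {m : ℤ × Fin n} (hm : m ∈ (toDistinct (ν.drop i)).head?) : 1 ≤ m.1 := by
  obtain ⟨u, hu, hiu, -, -, -, e⟩ := exists_stopsAt ν i (lt_length_of_mem_head? hm)
  rw [e, Option.mem_some_iff] at hm
  subst hm
  have := isPart_of_mem_setE h hu
  generalize halves ν[u] = p at *
  rcases p with a | ⟨a, b⟩ <;> simp only [IsPart, linked_iff, upper, shiftBy] at * <;> omega

/-- Induction along a run of `⋫` from its start, where `ℰ₁` applies. If the next part crosses `m`,
the previous part is `▷ m + 1`; since it is not `▷` the next part, that one must be `▷ m`. -/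
theorem tri_head_of_not_tri {ν : List (ColoredNumber n)} (h : ν ∈ setE1 n) (i : ℕ) :
    ∀ (hi : i + 1 < ν.length), ¬ (ν[i]).Tri ν[i + 1] →
      ∀ m ∈ (toDistinct (ν.drop (i + 1))).head?, (halves ν[i]).Tri (one m) := by
  obtain ⟨hE, hd⟩ := h
  have hgg := List.isChain_iff_getElem.1 hE.1
  induction i with
  | zero =>
    intro hi ht m hm
    exact (differentDistant_iff (by omega) (isOne_of_gg_of_not_tri (hgg 0 hi) ht).1
      (isPart_of_mem_setE hE _) hm (one_le_of_mem_head? hE hm)).1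
      (hd 0 hi (fun h0 => absurd h0 (lt_irrefl 0)) ht)
  | succ i ih =>
    intro hi ht m hm
    have h1 := (isOne_of_gg_of_not_tri (hgg (i + 1) hi) ht).1
    have hP := isPart_of_mem_setE hE (show i + 1 < ν.length by omega)
    by_cases ht' : (ν[i]).Tri ν[i + 1]
    · exact (differentDistant_iff (by omega) h1 hP hm (one_le_of_mem_head? hE hm)).1
        (hd (i + 1) hi (fun _ => ht') ht)
    · by_cases ha : Above (halves ν[i + 1]).bottom m
      · exact tri_one_of_above h1 hP ha (one_le_of_mem_head? hE hm)
      · have hr := ih (by omega) ht' (raise m) (by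
          rw [drop_toDistinct (by omega), head?_insertPiece_of_not h1 hm ha]; rfl)
        have h0 := (isOne_of_gg_of_not_tri (hgg i (by omega)) ht').1
        rw [← tri_halves_iff] at ht'
        generalize halves ν[i] = p at *
        generalize halves ν[i + 1] = q at *
        rcases p with a | ⟨a, b⟩
        · exact (h0 trivial).elim
        rcases q with c | ⟨c, d⟩
        · exact (h1 trivial).elim
        simp only [Tri, raise_fst, raise_snd] at *
        omega

theorem tri_head_of_mem_setE1 {ν : List (ColoredNumber n)} (h : ν ∈ setE1 n) (i : ℕ)
    (hi : i < ν.length) :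
    ∀ m ∈ (toDistinct (ν.drop (i + 1))).head?, (halves ν[i]).Tri (one m) := by
  intro m hm
  have hi' := lt_length_of_mem_head? hm
  by_cases ht : (ν[i]).Tri ν[i + 1]
  · have ih := tri_head_of_mem_setE1 h (i + 1) hi'
    rw [drop_toDistinct hi'] at hm
    exact tri_head_of_tri ((tri_halves_iff _ _).2 ht) (isPart_of_mem_setE h.1 _)
      (isPart_of_mem_setE h.1 _) ih m hm
  · exact tri_head_of_not_tri h i hi' ht m hm
termination_by ν.length - i

/-- `ℰ₁` consists of the sequences in which every insertion can be reverted. -/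
theorem good_map_halves_iff_mem_setE1 (ν : List (ColoredNumber n)) :
    Good (ν.map halves) ↔ ν ∈ setE1 n := by
  refine ⟨fun hG => ?_, fun h => (good_map_halves_iff ν).2 ⟨h.1, tri_head_of_mem_setE1 h⟩⟩
  obtain ⟨hE, ht⟩ := (good_map_halves_iff ν).1 hG
  refine ⟨hE, fun i hi _ h => ?_⟩
  obtain ⟨u, hu, -, -, -, -, hm⟩ := exists_stopsAt ν (i + 1) hi
  exact (differentDistant_iff (by omega)
    (isOne_of_gg_of_not_tri (List.isChain_iff_getElem.1 hE.1 i hi) h).1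
    (isPart_of_mem_setE hE _) hm (one_le_of_mem_head? hE hm)).2 (ht i (by omega) _ hm)

/-! ### The bijection between `ℰ₁` and `𝒪` -/

theorem sum_map_weight_halves (ν : List (ColoredNumber n)) :
    ((ν.map halves).map Piece.weight).sum = (size ν, colorProduct ν) := by
  induction ν with
  | nil => rfl
  | cons x ν ih =>
    rw [List.map_cons, List.map_cons, List.sum_cons, ih, weight_halves]
    simp [size, colorProduct]

theorem isDistinct_iff_map_mem_setO (L : List (ℤ × Fin n)) :
    IsDistinct L ↔ L.map primaryPart ∈ setO n := by
  simp only [IsDistinct, setO, Set.mem_ofPred_eq, List.isChain_map, succ_primaryPart_iff,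
    List.forall_mem_map]
  simp [ColoredNumber.IsPrimaryPart, primaryPart, Color.IsPrimary]

/-- Sequences in `𝒪` with given color product and size. -/
def distinctWith (C : Fin n →₀ ℕ) (m : ℕ) : Set (List (ℤ × Fin n)) :=
  {L | IsDistinct L ∧ (L.map weight).sum = ((m : ℤ), C)}

theorem bijOn_distinctWith_setO (C : Fin n →₀ ℕ) (m : ℕ) :
    Set.BijOn (List.map primaryPart) (distinctWith C m) (withColorSize (setO n) C m) := by
  have hw : ∀ L : List (ℤ × Fin n),
      (L.map weight).sum = (size (L.map primaryPart), colorProduct (L.map primaryPart)) := by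
    intro L
    rw [← sum_map_weight_halves, List.map_map, List.map_map]
    rfl
  have hm : ∀ L : List (ℤ × Fin n), L ∈ distinctWith C m ↔
      L.map primaryPart ∈ withColorSize (setO n) C m := by
    intro L
    simp only [distinctWith, withColorSize, Set.mem_ofPred_eq, hw, isDistinct_iff_map_mem_setO,
      Prod.mk.injEq]
    tauto
  refine ⟨fun L hL => (hm L).1 hL, ?_, fun l hl => ?_⟩
  · refine (List.map_injective_iff.2 fun a b h => ?_).injOn
    simpa [primaryPart, Prod.ext_iff] using h
  · have : ∃ L : List (ℤ × Fin n), L.map primaryPart = l := by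
      have h := hl.1.2
      clear hl
      induction l with
      | nil => exact ⟨[], rfl⟩
      | cons x l ih =>
        obtain ⟨L, rfl⟩ := ih fun y hy => h y (List.mem_cons_of_mem _ hy)
        obtain ⟨k, i | ⟨i, j, hij⟩⟩ := x
        · exact ⟨(k, i) :: L, rfl⟩
        · exact ((h _ List.mem_cons_self).1).elim
    obtain ⟨L, rfl⟩ := this
    exact ⟨L, (hm L).2 hl, rfl⟩

theorem bijOn_setE1_distinctWith (C : Fin n →₀ ℕ) (m : ℕ) :
    Set.BijOn toDistinct (withColorSize (setE1 n) C m) (distinctWith C m) := by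
  have hw : ∀ ν : List (ColoredNumber n),
      ((toDistinct ν).map weight).sum = (size ν, colorProduct ν) := by
    intro ν
    rw [toDistinct, weight_build, sum_map_weight_halves]
  refine ⟨fun ν hν => ?_, fun ν hν μ hμ h => ?_, fun L hL => ?_⟩
  · refine ⟨((good_map_halves_iff_mem_setE1 ν).2 hν.1).build_spec.1, ?_⟩
    rw [hw, hν.2.1, hν.2.2]
  · exact List.map_injective_iff.2 halves_injective
      (((good_map_halves_iff_mem_setE1 ν).2 hν.1).eq_of_build_eq
        ((good_map_halves_iff_mem_setE1 μ).2 hμ.1) h)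
  · obtain ⟨M, hM, rfl⟩ := exists_good_build_eq L hL.1
    have : ∃ ν : List (ColoredNumber n), ν.map halves = M := by
      clear hL
      induction M with
      | nil => exact ⟨[], rfl⟩
      | cons p M ih =>
        obtain ⟨ν, rfl⟩ := ih hM.2.1
        obtain ⟨x, rfl⟩ := exists_halves_eq hM.1
        exact ⟨x :: ν, rfl⟩
    obtain ⟨ν, rfl⟩ := this
    have hs := hL.2
    rw [← toDistinct, hw, Prod.mk.injEq] at hs
    exact ⟨ν, ⟨(good_map_halves_iff_mem_setE1 ν).1 hM, hs.2, hs.1⟩, rfl⟩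

/-! ### Distinct partitions as finite sets -/

/-- The pair `(i, k)` stands for the part `(k + 1)_{a_i}`. -/
def partOf (p : Fin n × ℕ) : ℤ × Fin n := (p.2 + 1, p.1)

/-- The exponents of the monomial `a_i q ^ (k + 1)`. -/
noncomputable def exponents (p : Fin n × ℕ) : Option (Fin n) →₀ ℕ :=
  Finsupp.single (some p.1) 1 + Finsupp.single none (p.2 + 1)

theorem sum_map_exponents (l : List (Fin n × ℕ)) :
    ((l.map partOf).map weight).sum =
      (((l.map exponents).sum none : ℤ), (l.map exponents).sum.some) := by
  induction l with
  | nil => ext <;> simp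
  | cons p l ih =>
    rw [List.map_cons, List.map_cons, List.sum_cons, ih, List.map_cons, List.sum_cons,
      Finsupp.some_add]
    simp [weight, partOf, exponents]

/-- Decreasing sequences of positive primary parts. -/
def IsDecreasing (l : List (Fin n × ℕ)) : Prop :=
  l.Pairwise fun p q => Above (partOf p) (partOf q)

theorem isDistinct_map_partOf (l : List (Fin n × ℕ)) :
    IsDistinct (l.map partOf) ↔ IsDecreasing l := by
  have : IsTrans (ℤ × Fin n) Above := ⟨fun a b c h h' => by unfold Above at *; omega⟩
  rw [IsDistinct, List.isChain_iff_pairwise, List.pairwise_map, IsDecreasing]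
  refine and_iff_left (List.forall_mem_map.2 fun p _ => ?_)
  simp only [partOf]; omega

theorem exists_map_partOf {L : List (ℤ × Fin n)} (h : ∀ a ∈ L, 1 ≤ a.1) :
    ∃ l : List (Fin n × ℕ), l.map partOf = L := by
  induction L with
  | nil => exact ⟨[], rfl⟩
  | cons a L ih =>
    obtain ⟨l, rfl⟩ := ih fun b hb => h b (List.mem_cons_of_mem _ hb)
    have := h a List.mem_cons_self
    refine ⟨(a.2, (a.1 - 1).toNat) :: l, ?_⟩
    rw [List.map_cons, partOf]
    congr 1
    ext <;> simp
    omega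

theorem IsDecreasing.nodup {l : List (Fin n × ℕ)} (h : IsDecreasing l) : l.Nodup :=
  List.Pairwise.imp (fun {p q} hpq e => by subst e; unfold Above at hpq; omega) h

theorem IsDecreasing.eq_of_toFinset_eq {l l' : List (Fin n × ℕ)} (h : IsDecreasing l)
    (h' : IsDecreasing l') (e : l.toFinset = l'.toFinset) : l = l' :=
  (List.perm_of_nodup_nodup_toFinset_eq h.nodup h'.nodup e).eq_of_pairwise
    (fun p q _ _ h1 h2 => by unfold Above at *; omega) h h'

theorem exists_isDecreasing (s : Finset (Fin n × ℕ)) :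
    ∃ l : List (Fin n × ℕ), IsDecreasing l ∧ l.toFinset = s := by
  induction hk : s.card generalizing s with
  | zero => exact ⟨[], .nil, (Finset.card_eq_zero.1 hk).symm⟩
  | succ k ih =>
    obtain ⟨p, hp, hmax⟩ := s.exists_max_image (fun p => toLex (p.2, p.1))
      (Finset.card_pos.1 (by omega))
    obtain ⟨l, hl, hs⟩ := ih (s.erase p) (by rw [Finset.card_erase_of_mem hp, hk]; rfl)
    refine ⟨p :: l, List.pairwise_cons.2 ⟨fun q hq => ?_, hl⟩, ?_⟩
    · rw [← List.mem_toFinset, hs, Finset.mem_erase] at hq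
      have h1 : q.2 < p.2 ∨ q.2 = p.2 ∧ q.1 ≤ p.1 := (Prod.Lex.le_iff ..).1 (hmax q hq.2)
      have h2 := hq.1
      rw [ne_eq, Prod.ext_iff, Fin.ext_iff] at h2
      simp only [Above, partOf]
      omega
    · rw [List.toFinset_cons, hs, Finset.insert_erase hp]

/-- The sets of parts with given exponents of the product of the monomials. -/
def setsWith (e : Option (Fin n) →₀ ℕ) : Set (Finset (Fin n × ℕ)) :=
  {s | ∑ p ∈ s, exponents p = e}

/-- The exponent of `q` bounds every part size, leaving finitely many parts to choose from. -/
theorem finite_setsWith (e : Option (Fin n) →₀ ℕ) : (setsWith e).Finite := by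
  refine (Finset.finite_toSet ((Finset.univ ×ˢ Finset.range (e none)).powerset)).subset
    fun s hs => ?_
  rw [Finset.mem_coe, Finset.mem_powerset]
  intro p hp
  have h1 : exponents p none ≤ (∑ p ∈ s, exponents p) none := by
    rw [Finsupp.finsetSum_apply]
    exact Finset.single_le_sum (f := fun p => exponents p none) (fun _ _ => Nat.zero_le _) hp
  have h2 : exponents p none = p.2 + 1 := by simp [exponents]
  rw [show ∑ p ∈ s, exponents p = e from hs, h2] at h1
  simp only [Finset.mem_product, Finset.mem_univ, true_and, Finset.mem_range]
  omega

theorem bijOn_setsWith_distinctWith (C : Fin n →₀ ℕ) (m : ℕ) :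
    ∃ f, Set.BijOn f (setsWith (C.optionElim m)) (distinctWith C m) := by
  choose f hf1 hf2 using exists_isDecreasing (n := n)
  have hw : ∀ l : List (Fin n × ℕ), l.Nodup → (l.toFinset ∈ setsWith (C.optionElim m) ↔
      ((l.map partOf).map weight).sum = ((m : ℤ), C)) := by
    intro l hl
    rw [setsWith, Set.mem_ofPred_eq, List.sum_toFinset _ hl, sum_map_exponents, Prod.mk.injEq]
    constructor
    · intro h
      rw [h]
      simp
    · rintro ⟨h1, h2⟩
      rw [← Finsupp.optionElim_some (l.map exponents).sum, h2, Nat.cast_injective h1]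
  refine ⟨fun s => (f s).map partOf, fun s hs => ?_, fun s _ t _ h => ?_, fun L hL => ?_⟩
  · refine ⟨(isDistinct_map_partOf _).2 (hf1 s), (hw _ (hf1 s).nodup).1 ?_⟩
    rwa [hf2]
  · have hp : Function.Injective (partOf (n := n)) := fun p q h => by
      simp only [partOf, Prod.mk.injEq] at h
      exact Prod.ext h.2 (by omega)
    rw [← hf2 s, ← hf2 t, List.map_injective_iff.2 hp h]
  · obtain ⟨l, rfl⟩ := exists_map_partOf hL.1.2
    have hl := (isDistinct_map_partOf l).1 hL.1
    refine ⟨l.toFinset, (hw l hl.nodup).2 hL.2, ?_⟩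
    exact congrArg _ ((hf1 _).eq_of_toFinset_eq hl (hf2 _))

theorem ncard_eq_of_bijOn {α β : Type*} {f : α → β} {s : Set α} {t : Set β}
    (h : Set.BijOn f s t) : s.ncard = t.ncard := by
  rw [← h.image_eq, h.injOn.ncard_image]

theorem finite_setO_and_setE1 (C : Fin n →₀ ℕ) (m : ℕ) :
    (withColorSize (setO n) C m).Finite ∧ (withColorSize (setE1 n) C m).Finite ∧
      countU C m = countW C m ∧ countU C m = (setsWith (C.optionElim m)).ncard := by
  obtain ⟨f, hf⟩ := bijOn_setsWith_distinctWith C m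
  have hO := bijOn_distinctWith_setO C m
  have hE := bijOn_setE1_distinctWith C m
  have hD : (distinctWith C m).Finite := hf.finite_iff_finite.1 (finite_setsWith _)
  refine ⟨hO.finite_iff_finite.1 hD, hE.finite_iff_finite.2 hD, ?_, ?_⟩
  · rw [countU, countW, ncard_eq_of_bijOn hE, ncard_eq_of_bijOn hO]
  · rw [countU, ← ncard_eq_of_bijOn hO, ncard_eq_of_bijOn hf]

/-! ### Generating functions -/

/-- The monomial `a_i q ^ (k + 1)`. -/
noncomputable def partTerm (p : Fin n × ℕ) : Series n := MvPowerSeries.monomial (exponents p) 1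

theorem prod_partTerm (s : Finset (Fin n × ℕ)) :
    ∏ p ∈ s, partTerm p = MvPowerSeries.monomial (∑ p ∈ s, exponents p) (1 : ℤ) := by
  induction s using Finset.cons_induction with
  | empty => simp [MvPowerSeries.monomial_zero_one]
  | cons p s hp ih =>
    rw [Finset.prod_cons, ih, partTerm, MvPowerSeries.monomial_mul_monomial, Finset.sum_cons,
      one_mul]

theorem one_add_partTerm (i : Fin n) (k : ℕ) :
    1 + partTerm (i, k) = (1 - (-varA i * varQ n) * varQ n ^ k : Series n) := by
  have : partTerm (i, k) = (varA i * varQ n ^ (k + 1) : Series n) := by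
    rw [partTerm, exponents, varA, varQ, MvPowerSeries.X_pow_eq, MvPowerSeries.X,
      MvPowerSeries.monomial_mul_monomial, one_mul]
  rw [this]
  ring

/-- The generating function of sequences of distinct primary parts. -/
noncomputable def distinctSeries (n : ℕ) : Series n := fun e => ((setsWith e).ncard : ℤ)

theorem coeff_distinctSeries (e : Option (Fin n) →₀ ℕ) :
    MvPowerSeries.coeff e (distinctSeries n) = ((setsWith e).ncard : ℤ) := rfl

/-- Each finite set contributes a single monomial with coefficient 1, so each coefficient is a
finite count. -/
theorem hasSum_distinctSeries : HasSum (∏ p ∈ ·, partTerm p) (distinctSeries n) := by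
  rw [MvPowerSeries.WithPiTopology.hasSum_iff_hasSum_coeff]
  intro e
  simp only [prod_partTerm, MvPowerSeries.coeff_monomial, coeff_distinctSeries]
  have hf := finite_setsWith e
  rw [Set.ncard_eq_toFinset_card _ hf]
  have h := hasSum_sum_of_ne_finset_zero (L := .unconditional (Finset (Fin n × ℕ)))
    (f := fun s => if e = ∑ p ∈ s, exponents p then (1 : ℤ) else 0) (s := hf.toFinset)
    fun s hs => if_neg fun h => hs ((Set.Finite.mem_toFinset hf).2 h.symm)
  rwa [Finset.sum_congr rfl fun s hs => if_pos ((Set.Finite.mem_toFinset hf).1 hs).symm,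
    Finset.sum_const, nsmul_one] at h

theorem multipliable_one_add_partTerm (i : Fin n) :
    Multipliable fun k : ℕ => 1 + partTerm (i, k) := by
  refine multipliable_one_add_of_summable_prod ?_
  rw [MvPowerSeries.WithPiTopology.summable_iff_summable_coeff]
  intro e
  let g : ℕ ↪ Fin n × ℕ := ⟨fun k => (i, k), fun _ _ h => (Prod.ext_iff.1 h).2⟩
  refine summable_of_hasFiniteSupport
    (((finite_setsWith e).preimage (Finset.map_injective g).injOn).subset fun s hs => ?_)
  have h : ∏ k ∈ s, partTerm (i, k) = ∏ p ∈ s.map g, partTerm p := by rw [Finset.prod_map]; rfl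
  rw [Function.mem_support, h, prod_partTerm, MvPowerSeries.coeff_monomial] at hs
  exact (by simpa using hs : e = _).symm

theorem prod_qPochhammerInf :
    ∏ i : Fin n, qPochhammerInf (-varA i * varQ n) = distinctSeries n := by
  -- Regularity permits regrouping the product over all pairs into one product per color.
  have : RegularSpace (Series n) := inferInstanceAs (RegularSpace ((Option (Fin n) →₀ ℕ) → ℤ))
  have h := (hasProd_one_add_of_hasSum_prod (hasSum_distinctSeries (n := n))).prod_fiberwise
    fun i => (multipliable_one_add_partTerm i).hasProd
  rw [h.unique (hasProd_fintype _)]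
  simp only [qPochhammerInf, one_add_partTerm]

theorem term_eq_monomial (c : ℕ) (u : Fin n →₀ ℕ) (m : ℕ) :
    term c u m = MvPowerSeries.monomial (u.optionElim m) (c : ℤ) := by
  have h : ∀ s : Finset (Fin n), (∏ i ∈ s, varA i ^ u i : Series n) =
      MvPowerSeries.monomial (∑ i ∈ s, Finsupp.single (some i) (u i)) 1 := by
    intro s
    induction s using Finset.cons_induction with
    | empty => simp [MvPowerSeries.monomial_zero_one]
    | cons i s hi ih =>
      rw [Finset.prod_cons, ih, varA, MvPowerSeries.X_pow_eq,
        MvPowerSeries.monomial_mul_monomial, Finset.sum_cons, one_mul]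
  have he : ∑ i, Finsupp.single (some i) (u i) + Finsupp.single none m = u.optionElim m := by
    ext o
    rcases o with _ | i
    · simp [Finsupp.finsetSum_apply]
    · simp [Finsupp.finsetSum_apply, Finsupp.single_apply]
  rw [term, h, varQ, MvPowerSeries.X_pow_eq, mul_assoc, MvPowerSeries.monomial_mul_monomial, he,
    one_mul, ← nsmul_eq_mul, ← map_nsmul, nsmul_eq_mul, mul_one]

theorem hasSum_term : HasSum (fun p : (Fin n →₀ ℕ) × ℕ => term (countU p.1 p.2) p.1 p.2)
    (distinctSeries n) := by
  rw [MvPowerSeries.WithPiTopology.hasSum_iff_hasSum_coeff]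
  intro e
  simp only [term_eq_monomial, MvPowerSeries.coeff_monomial, coeff_distinctSeries]
  convert hasSum_single (e.some, e none) ?_ using 1
  · rw [if_pos (Finsupp.optionElim_some e).symm, (finite_setO_and_setE1 _ _).2.2.2,
      Finsupp.optionElim_some]
  · rintro ⟨u, m⟩ hne
    refine if_neg ?_
    rintro rfl
    exact hne (by simp)

end Goellnitz

theorem mainTheorem1 (n : ℕ) :
    (∀ (C : Fin n →₀ ℕ) (m : ℕ),
      (Goellnitz.withColorSize (Goellnitz.setO n) C m).Finite ∧
      (Goellnitz.withColorSize (Goellnitz.setE1 n) C m).Finite ∧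
      Goellnitz.countU C m = Goellnitz.countW C m) ∧
    (∀ i : Fin n, Multipliable fun k : ℕ =>
      (1 - (-Goellnitz.varA i * Goellnitz.varQ n) * Goellnitz.varQ n ^ k : Goellnitz.Series n)) ∧
    HasSum
      (fun p : (Fin n →₀ ℕ) × ℕ => Goellnitz.term (Goellnitz.countW p.1 p.2) p.1 p.2)
      (∏ i : Fin n, Goellnitz.qPochhammerInf (-Goellnitz.varA i * Goellnitz.varQ n)) ∧
    HasSum
      (fun p : (Fin n →₀ ℕ) × ℕ => Goellnitz.term (Goellnitz.countU p.1 p.2) p.1 p.2)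
      (∏ i : Fin n, Goellnitz.qPochhammerInf (-Goellnitz.varA i * Goellnitz.varQ n)) := by
  have hc : ∀ (C : Fin n →₀ ℕ) (m : ℕ), Goellnitz.countU C m = Goellnitz.countW C m :=
    fun C m => (Goellnitz.finite_setO_and_setE1 C m).2.2.1
  refine ⟨fun C m => ?_, fun i => ?_, ?_, ?_⟩
  · obtain ⟨h1, h2, h3, -⟩ := Goellnitz.finite_setO_and_setE1 C m
    exact ⟨h1, h2, h3⟩
  · simpa only [Goellnitz.one_add_partTerm] using Goellnitz.multipliable_one_add_partTerm i
  · simpa only [Goellnitz.prod_qPochhammerInf, hc] using Goellnitz.hasSum_term (n := n)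
  · rw [Goellnitz.prod_qPochhammerInf]
    exact Goellnitz.hasSum_term
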